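/- Let $n,k\ge 0$ and $Q\ge 1$ be integers. Let $\mathcal A_Q(\mathbb R^k)$ be the set of unordered $Q$-tuples $[P_1]+\dots+[P_Q]$ of points of $\mathbb R^k$ (counted with multiplicity), with the metric $$\mathcal G\Big(\sum_{i=1}^Q [A_i],\sum_{i=1}^Q [B_i]\Big)=\min_{\sigma\in S_Q}\Big(\sum_{i=1}^Q|A_i-B_{\sigma(i)}|^2\Big)^{1/2}.$$ Let $B\subseteq\mathbb R^n$ be a Lebesgue measurable set without isolated points, and let $f:B\to\mathcal A_Q(\mathbb R^k)$ be Lebesgue measurable. For $x\in B$ set $$\mathrm{Lip} f(x)=\limsup_{y\to x,\ y\in B\setminus\{x\}}\frac{\mathcal G(f(y),f(x))}{|y-x|}\in[0,+\infty],\qquad A_f=\{x\in B:\ \mathrm{Lip} f(x)<+\infty\}.$$ We say that $f$ is differentiable at $x\in B$, where $f(x)=\sum_{i=1}^Q[P_i]$, if there are $k\times n$ real matrices $M_1,\dots,M_Q$ such that $M_i=M_j$ whenever $P_i=P_j$, and $$\lim_{y\to x,\ y\in B\setminus\{x\}}\frac{\mathcal G\big(f(y),\ \sum_{i=1}^Q[P_i+M_i(y-x)]\big)}{|y-x|}=0.$$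 Then $f$ is differentiable at almost every point of $A_f$: the set of points of $A_f$ at which $f$ is not differentiable is Lebesgue null. -/

import Mathlib

open Filter Topology MeasureTheory

/-- `QPoint M Q` is the space of unordered `Q`-tuples `[P₁] + ⋯ + [P_Q]` of points of `M`, counted
with multiplicity. It is a copy of `Sym M Q` that carries the Wasserstein-type metric below. -/
def QPoint (M : Type*) (Q : ℕ) : Type _ := Sym M Q

namespace QPoint

/-- The unordered tuple `[a₁] + ⋯ + [a_Q]`. -/
def ofTuple {M : Type*} {Q : ℕ} (a : Fin Q → M) : QPoint M Q :=
  (⟨(Finset.univ : Finset (Fin Q)).val.map a, by simp⟩ : Sym M Q)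

theorem ofTuple_eq_iff {M : Type*} {Q : ℕ} (a b : Fin Q → M) :
    ofTuple a = ofTuple b ↔ ∃ σ : Equiv.Perm (Fin Q), a = b ∘ σ := by
  constructor
  · intro h
    classical
    have hm : (Finset.univ : Finset (Fin Q)).val.map a = (Finset.univ : Finset (Fin Q)).val.map b :=
      congrArg (fun s : Sym M Q => (s : Multiset M)) h
    have hc : ∀ m, Nonempty ({i // a i = m} ≃ {i // b i = m}) := by
      intro m
      have hm' := congrArg (Multiset.count m) hm
      rw [Multiset.count_map, Multiset.count_map] at hm'
      refine ⟨Fintype.equivOfCardEq ?_⟩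
      rw [Fintype.card_subtype, Fintype.card_subtype]
      simpa only [Finset.card_def, Finset.filter_val, eq_comm] using hm'
    refine ⟨Equiv.ofFiberEquiv fun m => (hc m).some, funext fun i => ?_⟩
    exact (Equiv.ofFiberEquiv_map _ i).symm
  · rintro ⟨σ, rfl⟩
    have hm : (Finset.univ : Finset (Fin Q)).val.map (b ∘ σ) =
        (Finset.univ : Finset (Fin Q)).val.map b := by
      rw [← Multiset.map_map, Multiset.map_univ_val_equiv]
    exact Subtype.ext hm

theorem exists_ofTuple {M : Type*} {Q : ℕ} (A : QPoint M Q) : ∃ a : Fin Q → M, ofTuple a = A := by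
  obtain ⟨s, hs⟩ := A
  subst hs
  induction s using Quotient.inductionOn with
  | h l =>
    refine ⟨fun i => l.get i, Subtype.ext ?_⟩
    change (Finset.univ : Finset (Fin l.length)).val.map (fun i => l.get i) = (l : Multiset M)
    simp [Fin.univ_def, ← List.ofFn_eq_map]

/-- A choice of an enumeration of an unordered tuple. -/
noncomputable def rep {M : Type*} {Q : ℕ} (A : QPoint M Q) : Fin Q → M :=
  (exists_ofTuple A).choose

theorem ofTuple_rep {M : Type*} {Q : ℕ} (A : QPoint M Q) : ofTuple A.rep = A :=
  (exists_ofTuple A).choose_spec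

/-- `min_σ (∑ᵢ d(aᵢ, b_{σ(i)})²)^{1/2}` for two ordered tuples, `σ` running over all permutations. -/
noncomputable def tupleDist {M : Type*} [MetricSpace M] {Q : ℕ} (a b : Fin Q → M) : ℝ :=
  (Finset.univ : Finset (Equiv.Perm (Fin Q))).inf' Finset.univ_nonempty
    fun σ => Real.sqrt (∑ i, dist (a i) (b (σ i)) ^ 2)

theorem tupleDist_le {M : Type*} [MetricSpace M] {Q : ℕ} (a b : Fin Q → M)
    (σ : Equiv.Perm (Fin Q)) : tupleDist a b ≤ Real.sqrt (∑ i, dist (a i) (b (σ i)) ^ 2) :=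
  Finset.inf'_le _ (Finset.mem_univ σ)

theorem exists_tupleDist_eq {M : Type*} [MetricSpace M] {Q : ℕ} (a b : Fin Q → M) :
    ∃ σ : Equiv.Perm (Fin Q), tupleDist a b = Real.sqrt (∑ i, dist (a i) (b (σ i)) ^ 2) := by
  obtain ⟨σ, -, h⟩ := Finset.exists_mem_eq_inf' (Finset.univ_nonempty)
    fun σ : Equiv.Perm (Fin Q) => Real.sqrt (∑ i, dist (a i) (b (σ i)) ^ 2)
  exact ⟨σ, h⟩

theorem tupleDist_comm {M : Type*} [MetricSpace M] {Q : ℕ} (a b : Fin Q → M) :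
    tupleDist a b = tupleDist b a := by
  have key : ∀ a b : Fin Q → M, tupleDist a b ≤ tupleDist b a := by
    intro a b
    obtain ⟨σ, h⟩ := exists_tupleDist_eq b a
    refine (tupleDist_le a b σ⁻¹).trans (le_of_eq ?_)
    rw [h, ← Equiv.sum_comp σ]
    simp [dist_comm]
  exact le_antisymm (key a b) (key b a)

theorem tupleDist_comp_right {M : Type*} [MetricSpace M] {Q : ℕ} (a b : Fin Q → M)
    (τ : Equiv.Perm (Fin Q)) : tupleDist a (b ∘ τ) = tupleDist a b := by
  apply le_antisymm
  · obtain ⟨σ, h⟩ := exists_tupleDist_eq a b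
    refine (tupleDist_le _ _ (τ⁻¹ * σ)).trans (le_of_eq ?_)
    simp [h]
  · obtain ⟨σ, h⟩ := exists_tupleDist_eq a (b ∘ τ)
    refine (tupleDist_le _ _ (τ * σ)).trans (le_of_eq ?_)
    simp [h]

theorem tupleDist_triangle {M : Type*} [MetricSpace M] {Q : ℕ} (a b c : Fin Q → M) :
    tupleDist a c ≤ tupleDist a b + tupleDist b c := by
  obtain ⟨σ, h⟩ := exists_tupleDist_eq a b
  obtain ⟨τ, h'⟩ := exists_tupleDist_eq b c
  refine (tupleDist_le a c (τ * σ)).trans ?_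
  rw [h, h', ← Equiv.sum_comp σ (fun i => dist (b i) (c (τ i)) ^ 2)]
  have tri := norm_add_le (WithLp.toLp 2 fun i => dist (a i) (b (σ i)) : EuclideanSpace ℝ (Fin Q))
    (WithLp.toLp 2 fun i => dist (b (σ i)) (c (τ (σ i))))
  simp only [EuclideanSpace.norm_eq, PiLp.add_apply, Real.norm_eq_abs, sq_abs] at tri
  refine le_trans (Real.sqrt_le_sqrt (Finset.sum_le_sum fun i _ => ?_)) tri
  exact pow_le_pow_left₀ dist_nonneg (dist_triangle _ _ _) 2

/-- The Wasserstein-type metric `𝒢(A, B) = min_σ (∑ᵢ d(Aᵢ, B_{σ(i)})²)^{1/2}`; the value does not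
depend on the enumerations, see `dist_ofTuple`. -/
noncomputable instance instMetricSpace {M : Type*} [MetricSpace M] {Q : ℕ} :
    MetricSpace (QPoint M Q) where
  dist A B := tupleDist A.rep B.rep
  dist_self A := by
    apply le_antisymm
    · exact (tupleDist_le A.rep A.rep 1).trans (by simp)
    · obtain ⟨σ, h⟩ := exists_tupleDist_eq A.rep A.rep
      rw [h]
      exact Real.sqrt_nonneg _
  dist_comm A B := tupleDist_comm _ _
  dist_triangle A B C := tupleDist_triangle _ _ _
  eq_of_dist_eq_zero := by
    intro A B hAB
    change tupleDist A.rep B.rep = 0 at hAB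
    obtain ⟨σ, h⟩ := exists_tupleDist_eq A.rep B.rep
    rw [hAB, eq_comm, Real.sqrt_eq_zero (Finset.sum_nonneg fun _ _ => sq_nonneg _),
      Finset.sum_eq_zero_iff_of_nonneg fun _ _ => sq_nonneg _] at h
    rw [← ofTuple_rep A, ← ofTuple_rep B, ofTuple_eq_iff]
    refine ⟨σ, funext fun i => ?_⟩
    have hi := h i (Finset.mem_univ i)
    exact dist_eq_zero.1 (pow_eq_zero_iff (two_ne_zero) |>.1 hi)

theorem dist_ofTuple {M : Type*} [MetricSpace M] {Q : ℕ} (a b : Fin Q → M) :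
    dist (ofTuple a) (ofTuple b) =
      (Finset.univ : Finset (Equiv.Perm (Fin Q))).inf' Finset.univ_nonempty
        fun σ => Real.sqrt (∑ i, dist (a i) (b (σ i)) ^ 2) := by
  change tupleDist (ofTuple a).rep (ofTuple b).rep = tupleDist a b
  obtain ⟨σ, hσ⟩ := (ofTuple_eq_iff _ _).1 (ofTuple_rep (ofTuple a))
  obtain ⟨τ, hτ⟩ := (ofTuple_eq_iff _ _).1 (ofTuple_rep (ofTuple b))
  rw [hσ, hτ, tupleDist_comp_right, tupleDist_comm, tupleDist_comp_right, tupleDist_comm]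

end QPoint

/-- Lebesgue measurability of a map `f` defined on a subset `B` of `ℝⁿ`: preimages of open sets are
Lebesgue measurable subsets of `ℝⁿ`. -/
def LebesgueMeasurableOn {n : ℕ} {Y : Type*} [TopologicalSpace Y]
    {B : Set (EuclideanSpace ℝ (Fin n))} (f : B → Y) : Prop :=
  ∀ U : Set Y, IsOpen U →
    NullMeasurableSet ((fun y : B => (y : EuclideanSpace ℝ (Fin n))) '' (f ⁻¹' U)) volume

/-- The upper pointwise Lipschitz constant
`limsup_{y ∈ B, y → x, y ≠ x} 𝒢(f(y), f(x)) / |y - x|`, with values in `[0, ∞]`. -/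
noncomputable def pointwiseLip {n k Q : ℕ} {B : Set (EuclideanSpace ℝ (Fin n))}
    (f : B → QPoint (EuclideanSpace ℝ (Fin k)) Q) (x : B) : ENNReal :=
  limsup (fun y : B => ENNReal.ofReal (dist (f y) (f x) /
    ‖(y : EuclideanSpace ℝ (Fin n)) - (x : EuclideanSpace ℝ (Fin n))‖)) (𝓝[≠] x)

/-- The set `A_f` of the points of `B` at which the upper pointwise Lipschitz constant is finite. -/
def finiteLipSet {n k Q : ℕ} {B : Set (EuclideanSpace ℝ (Fin n))}
    (f : B → QPoint (EuclideanSpace ℝ (Fin k)) Q) : Set B :=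
  {x | pointwiseLip f x < ⊤}

/-- Differentiability of a `Q`-valued map `f : B → 𝒜_Q(ℝᵏ)` at `x ∈ B`: one has
`f(x) = [P₁] + ⋯ + [P_Q]` and linear maps `Lᵢ : ℝⁿ → ℝᵏ` such that `Lᵢ = Lⱼ` whenever `Pᵢ = Pⱼ` and
`𝒢(f(y), ∑ᵢ [Pᵢ + Lᵢ(y - x)]) / |y - x| → 0` as `y → x`, `y ∈ B`, `y ≠ x`. -/
def QDifferentiableAt {n k Q : ℕ} {B : Set (EuclideanSpace ℝ (Fin n))}
    (f : B → QPoint (EuclideanSpace ℝ (Fin k)) Q) (x : B) : Prop :=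
  ∃ (P : Fin Q → EuclideanSpace ℝ (Fin k))
    (L : Fin Q → EuclideanSpace ℝ (Fin n) →L[ℝ] EuclideanSpace ℝ (Fin k)),
    f x = QPoint.ofTuple P ∧
    (∀ i j, P i = P j → L i = L j) ∧
    Tendsto (fun y : B =>
      dist (f y) (QPoint.ofTuple fun i =>
        P i + L i ((y : EuclideanSpace ℝ (Fin n)) - (x : EuclideanSpace ℝ (Fin n)))) /
      ‖(y : EuclideanSpace ℝ (Fin n)) - (x : EuclideanSpace ℝ (Fin n))‖) (𝓝[≠] x) (𝓝 0)

namespace QPoint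

/-! The proof reduces to Rademacher's theorem for single-valued maps. Each point of finite pointwise
Lipschitz constant lies in one of countably many pieces `lipschitzPiece`, indexed by a Lipschitz
scale, a small ball, and well-separated centres near the values. On a piece the coincidence pattern
of the values is fixed, and separation forces the optimal matching to respect the labels
(`dist_apply_le_dist_ofTuple`). So `f` splits there into `Q` Lipschitz maps, differentiable within
the piece almost everywhere. Differentiability along the piece extends to all of `B` at density
points: a nearby `y` is within `o(|y - x|)` of the piece, and the Lipschitz bound at points of the
piece controls the error. -/

theorem dist_ofTuple_le_sum {M : Type*} [MetricSpace M] {Q : ℕ} (a b : Fin Q → M) :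
    dist (ofTuple a) (ofTuple b) ≤ ∑ i, dist (a i) (b i) := by
  rw [dist_ofTuple]
  refine (tupleDist_le a b 1).trans (Real.sqrt_le_iff.2 ⟨by positivity, ?_⟩)
  exact Finset.sum_sq_le_sq_sum_of_nonneg fun i _ => dist_nonneg

/-- If two tuples have their entries close to the same well-separated centres, and entries with the
same centre agree, then the given enumerations are matched entrywise by the metric. -/
theorem dist_apply_le_dist_ofTuple {M : Type*} [MetricSpace M] {Q : ℕ} {a b c : Fin Q → M} {δ : ℝ}
    (ha : ∀ i, dist (a i) (c i) < δ) (hb : ∀ i, dist (b i) (c i) < δ)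
    (hsep : ∀ i j, b i ≠ b j → 4 * δ ≤ dist (c i) (c j)) (i : Fin Q) :
    dist (a i) (b i) ≤ dist (ofTuple a) (ofTuple b) := by
  obtain ⟨σ, h⟩ := exists_tupleDist_eq a b
  have hle : dist (a i) (b (σ i)) ≤ dist (ofTuple a) (ofTuple b) := by
    rw [dist_ofTuple]
    change _ ≤ tupleDist a b
    rw [h]
    refine Real.le_sqrt_of_sq_le ?_
    exact Finset.single_le_sum (f := fun i => dist (a i) (b (σ i)) ^ 2)
      (fun j _ => sq_nonneg _) (Finset.mem_univ i)
  refine le_trans ?_ hle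
  by_cases hi : b i = b (σ i)
  · rw [hi]
  -- A mismatched pair is more than `4δ - 2δ = 2δ` apart, while `a i` and `b i` are less than `2δ`
  -- apart.
  · have h1 := hsep _ _ hi
    have h2 := dist_triangle4 (c i) (a i) (b (σ i)) (c (σ i))
    have h3 := dist_triangle_right (a i) (b i) (c i)
    have h4 := ha i
    have h5 := hb i
    have h6 := hb (σ i)
    rw [dist_comm (c i) (a i)] at h2
    linarith

/-- A tuple has its entries close to well-separated points of a countable dense set. -/
theorem exists_separated_centres {M : Type*} [MetricSpace M] {Q : ℕ} {d : ℕ → M}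
    (hd : DenseRange d) (a : Fin Q → M) :
    ∃ (m : ℕ) (c : Fin Q → ℕ), (∀ i, dist (a i) (d (c i)) < 1 / (m + 1 : ℝ)) ∧
      (∀ i j, a i = a j ↔ c i = c j) ∧
      ∀ i j, a i ≠ a j → 4 * (1 / (m + 1 : ℝ)) ≤ dist (d (c i)) (d (c j)) := by
  -- Moving both points to their centres costs less than `2 / (m + 1)`, which leaves the required `4
  -- / (m + 1)`.
  have hpos : ∀ᶠ m : ℕ in atTop, ∀ i j, a i ≠ a j → 6 * (1 / (m + 1 : ℝ)) < dist (a i) (a j) := by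
    refine eventually_all.2 fun i => eventually_all.2 fun j => ?_
    by_cases h : a i = a j
    · simp [h]
    · have ht := (tendsto_one_div_add_atTop_nhds_zero_nat (𝕜 := ℝ)).const_mul 6
      rw [mul_zero] at ht
      filter_upwards [ht.eventually_lt_const (dist_pos.2 h)] with m hm _ using hm
  obtain ⟨m, hm⟩ := hpos.exists
  have hδ : (0 : ℝ) < 1 / (m + 1 : ℝ) := by positivity
  choose e he using fun p : M => hd.exists_dist_lt p hδ
  have hsep : ∀ i j, a i ≠ a j → 4 * (1 / (m + 1 : ℝ)) ≤ dist (d (e (a i))) (d (e (a j))) := by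
    intro i j hij
    have h1 := hm i j hij
    have h2 := dist_triangle4 (a i) (d (e (a i))) (d (e (a j))) (a j)
    have h3 := he (a i)
    have h4 := he (a j)
    rw [dist_comm (a j)] at h4
    linarith
  refine ⟨m, fun i => e (a i), fun i => he _, fun i j => ⟨fun h => congrArg e h, fun h => ?_⟩, hsep⟩
  by_contra hij
  have := hsep i j hij
  rw [show e (a i) = e (a j) from h, dist_self] at this
  linarith

end QPoint

/-! ### Density points -/

open scoped Pointwise in
/-- Near almost every point `x` of a set `s`, every `y` is at distance `o(|y - x|)` from `s`. -/
theorem ae_mem_forall_exists_dist_le {F : Type*} [NormedAddCommGroup F] [NormedSpace ℝ F]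
    [FiniteDimensional ℝ F] [MeasurableSpace F] [BorelSpace F] (μ : Measure F)
    [μ.IsAddHaarMeasure] (s : Set F) :
    ∀ᵐ x ∂μ, x ∈ s → ∀ ε > 0, ∃ r > 0, ∀ y, y ≠ x → dist y x < r →
      ∃ z ∈ s, dist z y ≤ ε * dist y x := by
  filter_upwards [ae_imp_of_ae_restrict (Besicovitch.ae_tendsto_measure_inter_div μ s)]
    with x hx hxs ε hε
  have hε2 : 0 < ε / 2 := by positivity
  obtain ⟨t, -, ht, hcov⟩ := (isCompact_sphere (0 : F) 1).finite_cover_balls hε2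
  -- At a density point every small rescaled copy of a fixed ball meets `s`. Finitely many
  -- directions `u` suffice, so one radius serves them all.
  have key : ∀ᶠ r in 𝓝[>] (0 : ℝ), ∀ u ∈ t,
      (s ∩ ({x} + r • Metric.ball u (ε / 2))).Nonempty := by
    refine ht.eventually_all.2 fun u _ => ?_
    exact Measure.eventually_nonempty_inter_smul_of_density_one μ s x (hx hxs) _
      measurableSet_ball (Metric.measure_ball_pos μ u hε2).ne'
  obtain ⟨r, hr, hr'⟩ := Metric.mem_nhdsWithin_iff.1 key
  refine ⟨r, hr, fun y hy hyr => ?_⟩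
  have hD : 0 < dist y x := dist_pos.2 hy
  have hu : (dist y x)⁻¹ • (y - x) ∈ Metric.sphere (0 : F) 1 := by
    rw [mem_sphere_zero_iff_norm, norm_smul, norm_inv, Real.norm_of_nonneg hD.le, ← dist_eq_norm,
      inv_mul_cancel₀ hD.ne']
  obtain ⟨v, hv, huv⟩ := Set.mem_iUnion₂.1 (hcov hu)
  obtain ⟨z, hzs, hz⟩ := hr' (a := dist y x)
    ⟨by rwa [Metric.mem_ball, Real.dist_0_eq_abs, abs_of_pos hD], hD⟩ v hv
  refine ⟨z, hzs, ?_⟩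
  rw [Set.singleton_add, Set.mem_image] at hz
  obtain ⟨_, ⟨w, hw, rfl⟩, rfl⟩ := hz
  have hwu : dist w ((dist y x)⁻¹ • (y - x)) ≤ ε := by
    have h1 := dist_triangle_right w ((dist y x)⁻¹ • (y - x)) v
    rw [Metric.mem_ball] at hw huv
    linarith
  have hy' : y = x + dist y x • ((dist y x)⁻¹ • (y - x)) := by
    rw [smul_inv_smul₀ hD.ne', add_sub_cancel]
  calc dist (x + dist y x • w) y
      = dist (x + dist y x • w) (x + dist y x • ((dist y x)⁻¹ • (y - x))) := by rw [← hy']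
    _ = dist y x * dist w ((dist y x)⁻¹ • (y - x)) := by
        rw [dist_add_left, dist_smul₀, Real.norm_of_nonneg hD.le]
    _ ≤ ε * dist y x := by rw [mul_comm]; gcongr

/-! ### Splitting into single-valued Lipschitz maps -/

section

variable {n k Q : ℕ} {B : Set (EuclideanSpace ℝ (Fin n))}
  {f : B → QPoint (EuclideanSpace ℝ (Fin k)) Q}

theorem exists_lipschitz_scale_of_mem_finiteLipSet {x : B} (hx : x ∈ finiteLipSet f) :
    ∃ N : ℕ, ∀ y : B, dist y x < 1 / (N + 1 : ℝ) → dist (f y) (f x) ≤ N * dist y x := by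
  obtain ⟨C, hC, -⟩ := ENNReal.lt_iff_exists_nnreal_btwn.1 (show pointwiseLip f x < ⊤ from hx)
  obtain ⟨r, hr, hlt⟩ := Metric.mem_nhdsWithin_iff.1 (eventually_lt_of_limsup_lt hC)
  obtain ⟨N₁, hN₁⟩ := exists_nat_ge (C : ℝ)
  obtain ⟨N₂, hN₂⟩ := exists_nat_one_div_lt hr
  refine ⟨max N₁ N₂, fun y hy => ?_⟩
  rcases eq_or_ne y x with rfl | hne
  · simp
  have hyr : dist y x < r := by
    refine hy.trans (lt_of_le_of_lt ?_ hN₂)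
    gcongr
    exact le_max_right _ _
  have h1 : ENNReal.ofReal (dist (f y) (f x) /
      ‖(y : EuclideanSpace ℝ (Fin n)) - (x : EuclideanSpace ℝ (Fin n))‖) < C := hlt ⟨hyr, hne⟩
  have hD : 0 < dist y x := dist_pos.2 hne
  rw [← ENNReal.ofReal_coe_nnreal, ENNReal.ofReal_lt_ofReal_iff_of_nonneg (by positivity),
    ← dist_eq_norm, ← Subtype.dist_eq, div_lt_iff₀ hD] at h1
  refine h1.le.trans ?_
  gcongr
  exact hN₁.trans (by exact_mod_cast le_max_left _ _)

/-- A multi-valued map is differentiable at a point `x` of density of a set `E` near which it is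
Lipschitz and on which it splits into single-valued maps that are differentiable at `x`. -/
theorem qDifferentiableAt_of_splitting {E : Set (EuclideanSpace ℝ (Fin n))} (hEB : E ⊆ B)
    {P : EuclideanSpace ℝ (Fin n) → Fin Q → EuclideanSpace ℝ (Fin k)} {C r : ℝ} (hC : 0 ≤ C)
    (hr : 0 < r) (hP : ∀ x (hx : x ∈ E), f ⟨x, hEB hx⟩ = QPoint.ofTuple (P x))
    (heq : ∀ i j, ∀ x ∈ E, P x i = P x j → ∀ y ∈ E, P y i = P y j)
    (hlip : ∀ z (hz : z ∈ E) (y : B), dist (y : EuclideanSpace ℝ (Fin n)) z < r →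
      dist (f y) (f ⟨z, hEB hz⟩) ≤ C * dist (y : EuclideanSpace ℝ (Fin n)) z)
    {x : EuclideanSpace ℝ (Fin n)} (hx : x ∈ E)
    (hdiff : ∀ i, DifferentiableWithinAt ℝ (fun y => P y i) E x)
    (hdens : ∀ ε > 0, ∃ r > 0, ∀ y, y ≠ x → dist y x < r → ∃ z ∈ E, dist z y ≤ ε * dist y x) :
    QDifferentiableAt f ⟨x, hEB hx⟩ := by
  set L := fun i => fderivWithin ℝ (fun y => P y i) E x with hL
  refine ⟨P x, L, hP x hx, fun i j hij => ?_, ?_⟩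
  -- Branches that agree at `x` agree on all of `E`, so they have the same derivative within `E`.
  · exact fderivWithin_congr (fun y hy => heq i j x hx hij y hy) hij
  -- With `z ∈ E` close to `y`: `C` pays for passing from `f y` to `f z`, `2` for the linearisation
  -- error at `z` (as `|z - x| ≤ 2|y - x|`), and `‖L i‖` for replacing `z` by `y` in the linear
  -- part.
  set K := C + ∑ i, (2 + ‖L i‖) with hK
  have hK0 : 0 ≤ K := by positivity
  refine Metric.tendsto_nhdsWithin_nhds.2 fun ε hε => ?_
  obtain ⟨η, hη, hη1, hηK⟩ : ∃ η > 0, η ≤ 1 ∧ K * η < ε := by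
    refine ⟨min 1 (ε / (K + 1)), by positivity, min_le_left _ _, ?_⟩
    calc K * min 1 (ε / (K + 1)) ≤ K * (ε / (K + 1)) := by gcongr; exact min_le_right _ _
      _ < (K + 1) * (ε / (K + 1)) := by gcongr; linarith
      _ = ε := by field_simp
  have hev : ∀ᶠ z in 𝓝[E] x, ∀ i, ‖P z i - P x i - L i (z - x)‖ ≤ η * ‖z - x‖ :=
    eventually_all.2 fun i => (hdiff i).hasFDerivWithinAt.isLittleO.bound hη
  obtain ⟨ρ, hρ, hev⟩ := Metric.mem_nhdsWithin_iff.1 hev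
  obtain ⟨s, hs, hdens⟩ := hdens η hη
  refine ⟨min s (min r (ρ / 2)), by positivity, fun {y} hyne hy => ?_⟩
  obtain ⟨y, hyB⟩ := y
  have hyne : y ≠ x := fun h => hyne (Subtype.ext h)
  rw [Subtype.dist_eq, lt_min_iff, lt_min_iff] at hy
  simp only at hy
  obtain ⟨hys, hyr, hyρ⟩ := hy
  obtain ⟨z, hzE, hz⟩ := hdens y hyne hys
  have hD : 0 < dist y x := dist_pos.2 hyne
  have hzy : dist z y ≤ dist y x := hz.trans (mul_le_of_le_one_left hD.le hη1)
  have hzx : dist z x ≤ 2 * dist y x := by linarith [dist_triangle z y x]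
  have hfyz : dist (f ⟨y, hyB⟩) (f ⟨z, hEB hzE⟩) ≤ C * (η * dist y x) := by
    refine (hlip z hzE ⟨y, hyB⟩ ?_).trans ?_
    · rw [dist_comm]; exact hzy.trans_lt hyr
    · simp only [dist_comm y z]; gcongr
  have hcomp : ∀ i, dist (P z i) (P x i + L i (y - x)) ≤ (2 + ‖L i‖) * (η * dist y x) := by
    intro i
    have h1 := hev (a := z) ⟨by rw [Metric.mem_ball]; linarith, hzE⟩ i
    have h2 := (L i).le_opNorm (z - y)
    have h3 : P z i - (P x i + L i (y - x)) = (P z i - P x i - L i (z - x)) + L i (z - y) := by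
      simp only [map_sub]; abel
    rw [← dist_eq_norm z x] at h1
    rw [← dist_eq_norm z y] at h2
    have h4 : η * dist z x ≤ 2 * (η * dist y x) := by
      calc η * dist z x ≤ η * (2 * dist y x) := by gcongr
        _ = _ := by ring
    have h5 : ‖L i‖ * dist z y ≤ ‖L i‖ * (η * dist y x) := by gcongr
    rw [dist_eq_norm, h3]
    linarith [norm_add_le (P z i - P x i - L i (z - x)) (L i (z - y))]
  have htot : dist (f ⟨y, hyB⟩) (QPoint.ofTuple fun i => P x i + L i (y - x)) ≤
      K * η * dist y x := by
    calc _ ≤ dist (f ⟨y, hyB⟩) (f ⟨z, hEB hzE⟩) +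
          dist (f ⟨z, hEB hzE⟩) (QPoint.ofTuple fun i => P x i + L i (y - x)) :=
          dist_triangle _ _ _
      _ ≤ C * (η * dist y x) + ∑ i, (2 + ‖L i‖) * (η * dist y x) := by
          refine add_le_add hfyz ?_
          rw [hP z hzE]
          exact (QPoint.dist_ofTuple_le_sum _ _).trans (Finset.sum_le_sum fun i _ => hcomp i)
      _ = K * η * dist y x := by rw [← Finset.sum_mul, hK]; ring
  rw [Real.dist_0_eq_abs, abs_of_nonneg (by positivity), ← dist_eq_norm, div_lt_iff₀ hD]
  exact htot.trans_lt (by gcongr)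

/-- The points with prescribed Lipschitz scale `N`, lying in a ball of radius comparable to that
scale, whose values cluster with fineness `m` around the centres labelled by `c`. -/
def lipschitzPiece (f : B → QPoint (EuclideanSpace ℝ (Fin k)) Q) (N q m : ℕ) (c : Fin Q → ℕ) :
    Set (EuclideanSpace ℝ (Fin n)) :=
  {x | ∃ hx : x ∈ B,
    (∀ y : B, dist y ⟨x, hx⟩ < 1 / (N + 1 : ℝ) →
      dist (f y) (f ⟨x, hx⟩) ≤ N * dist y ⟨x, hx⟩) ∧
    dist x (TopologicalSpace.denseSeq (EuclideanSpace ℝ (Fin n)) q) < 1 / (N + 1 : ℝ) / 2 ∧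
    ∃ a : Fin Q → EuclideanSpace ℝ (Fin k), f ⟨x, hx⟩ = QPoint.ofTuple a ∧
      (∀ i, dist (a i) (TopologicalSpace.denseSeq _ (c i)) < 1 / (m + 1 : ℝ)) ∧
      (∀ i j, a i = a j ↔ c i = c j) ∧
      ∀ i j, a i ≠ a j → 4 * (1 / (m + 1 : ℝ)) ≤
        dist (TopologicalSpace.denseSeq (EuclideanSpace ℝ (Fin k)) (c i))
          (TopologicalSpace.denseSeq _ (c j))}

theorem exists_mem_lipschitzPiece {x : B} (hx : x ∈ finiteLipSet f) :
    ∃ N q m c, (x : EuclideanSpace ℝ (Fin n)) ∈ lipschitzPiece f N q m c := by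
  obtain ⟨N, hN⟩ := exists_lipschitz_scale_of_mem_finiteLipSet hx
  obtain ⟨q, hq⟩ := (TopologicalSpace.denseRange_denseSeq (EuclideanSpace ℝ (Fin n))).exists_dist_lt
    (x : EuclideanSpace ℝ (Fin n)) (show 0 < 1 / (N + 1 : ℝ) / 2 by positivity)
  obtain ⟨a, ha⟩ := QPoint.exists_ofTuple (f x)
  obtain ⟨m, c, h⟩ := QPoint.exists_separated_centres (TopologicalSpace.denseRange_denseSeq _) a
  exact ⟨N, q, m, c, x.2, hN, hq, a, ha.symm, h⟩

/-- The enumerations labelled by `c` are Lipschitz branches on the piece, so Rademacher and density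
apply; both hold for arbitrary sets, measurable or not. -/
theorem ae_qDifferentiableAt_of_mem_lipschitzPiece (N q m : ℕ) (c : Fin Q → ℕ) :
    ∀ᵐ x ∂(volume : Measure (EuclideanSpace ℝ (Fin n))), ∀ hx : x ∈ B,
      x ∈ lipschitzPiece f N q m c → QDifferentiableAt f ⟨x, hx⟩ := by
  set E := lipschitzPiece f N q m c with hE
  have hEB : E ⊆ B := fun x hx => hx.1
  have hex : ∀ x, ∃ a : Fin Q → EuclideanSpace ℝ (Fin k), ∀ hx : x ∈ E,
      f ⟨x, hEB hx⟩ = QPoint.ofTuple a ∧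
      (∀ i, dist (a i) (TopologicalSpace.denseSeq _ (c i)) < 1 / (m + 1 : ℝ)) ∧
      (∀ i j, a i = a j ↔ c i = c j) ∧
      ∀ i j, a i ≠ a j → 4 * (1 / (m + 1 : ℝ)) ≤
        dist (TopologicalSpace.denseSeq (EuclideanSpace ℝ (Fin k)) (c i))
          (TopologicalSpace.denseSeq _ (c j)) := by
    intro x
    by_cases hx : x ∈ E
    · obtain ⟨a, ha⟩ := hx.2.2.2
      exact ⟨a, fun _ => ha⟩
    -- The value off `E` is irrelevant, since derivatives are taken within `E`.
    · exact ⟨0, fun h => (hx h).elim⟩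
  choose P hP using hex
  have hlip : ∀ z (hz : z ∈ E) (y : B), dist (y : EuclideanSpace ℝ (Fin n)) z < 1 / (N + 1 : ℝ) →
      dist (f y) (f ⟨z, hEB hz⟩) ≤ N * dist (y : EuclideanSpace ℝ (Fin n)) z :=
    fun z hz y hy => hz.2.1 y hy
  have hPlip : ∀ i, LipschitzOnWith N (fun y => P y i) E := by
    refine fun i => LipschitzOnWith.of_dist_le_mul fun x hx y hy => ?_
    obtain ⟨hfx, hax, -, -⟩ := hP x hx
    obtain ⟨hfy, hay, -, hsep⟩ := hP y hy
    refine (QPoint.dist_apply_le_dist_ofTuple hax hay hsep i).trans ?_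
    rw [← hfx, ← hfy]
    refine hlip y hy ⟨x, hEB hx⟩ ?_
    -- Both points lie in a ball of half the Lipschitz scale, so their distance is below that scale.
    have h1 := hx.2.2.1
    have h2 := hy.2.2.1
    have h3 := dist_triangle_right x y (TopologicalSpace.denseSeq (EuclideanSpace ℝ (Fin n)) q)
    change dist x y < _
    linarith
  filter_upwards [ae_all_iff.2 fun i => (hPlip i).ae_differentiableWithinAt_of_mem (μ := volume),
    ae_mem_forall_exists_dist_le volume E] with x hdiff hdens _ hx
  refine qDifferentiableAt_of_splitting hEB (Nat.cast_nonneg N) (by positivity)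
    (fun z hz => (hP z hz).1) ?_ hlip hx (fun i => hdiff i hx) (hdens hx)
  intro i j z hz hij y hy
  exact ((hP y hy).2.2.1 i j).2 (((hP z hz).2.2.1 i j).1 hij)

end

theorem theorem1p2 (n k Q : ℕ) (hQ : 0 < Q) (B : Set (EuclideanSpace ℝ (Fin n)))
    (hB : NullMeasurableSet B volume) (hiso : Preperfect B)
    (f : B → QPoint (EuclideanSpace ℝ (Fin k)) Q) (hf : LebesgueMeasurableOn f) :
    ∀ᵐ x ∂(volume : Measure (EuclideanSpace ℝ (Fin n))),
      ∀ hx : x ∈ B, (⟨x, hx⟩ : B) ∈ finiteLipSet f → QDifferentiableAt f ⟨x, hx⟩ := by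
  have h : ∀ᵐ x ∂(volume : Measure (EuclideanSpace ℝ (Fin n))), ∀ (N q m : ℕ) (c : Fin Q → ℕ),
      ∀ hx : x ∈ B, x ∈ lipschitzPiece f N q m c → QDifferentiableAt f ⟨x, hx⟩ := by
    simp only [ae_all_iff (ι := ℕ), ae_all_iff (ι := Fin Q → ℕ)]
    exact ae_qDifferentiableAt_of_mem_lipschitzPiece
  filter_upwards [h] with x h hx hfin
  obtain ⟨N, q, m, c, hmem⟩ := exists_mem_lipschitzPiece hfin
  exact h N q m c hx hmem
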